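/- Let $k$ be a field, let $n \ge 0$, and let $R = k[X_1,\dots,X_n]$. Let $f_1,\dots,f_n \in R$ be homogeneous polynomials of degrees $d_1,\dots,d_n$ respectively, and suppose that the ideal $I = (f_1,\dots,f_n)$ of $R$ has height $n$ (in particular, $I$ is a proper ideal). Put $\mathfrak m = (X_1,\dots,X_n)R$ and $\delta = d_1 + \dots + d_n - n$. Then $\delta \ge 0$, and for all integers $i = 0, 1, \dots, \delta+1$, $$I : \mathfrak m^i = I + \mathfrak m^{\delta+1-i},$$ where $I : J = \{ r \in R \mid rJ \subseteq I \}$ for an ideal $J$ of $R$, and $\mathfrak m^0 = R$. -/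

import Mathlib

/-! The claim is reduced to the monomial ideal J = (X_1^N, …, X_n^N). Since I is homogeneous of
height n, J ⊆ I for large N, so (X_i^N) = C f with C a matrix of forms and det C a form of degree nN
- ∑ d_j. Then r ∈ I iff r det C ∈ J: Cramer's rule gives one direction, and comparison of Koszul
complexes (`Ideal.mem_span_of_mul_det_mem_span`) the other. Modulo J, monomials of degree above
n(N-1) vanish, and any surviving monomial can be multiplied up to that degree without vanishing;
shifting degrees by deg det C turns n(N-1) into δ. -/

theorem Module.Basis.mem_ideal_smul_top_iff {A M ι : Type*} [CommRing A] [AddCommGroup M]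
    [Module A M] (b : Module.Basis ι A M) (G : Ideal A) (u : M) :
    u ∈ G • (⊤ : Submodule A M) ↔ ∀ s, b.repr u s ∈ G := by
  constructor
  · intro h s
    induction h using Submodule.smul_induction_on' with
    | smul r hr x _ => simpa using G.mul_mem_right _ hr
    | add x _ y _ hx hy => simpa using G.add_mem hx hy
  · intro h
    rw [← b.linearCombination_repr u, Finsupp.linearCombination_apply]
    exact Submodule.sum_mem _ fun s _ => Submodule.smul_mem_smul (h s) trivial

/-! ### Koszul differential and comparison by determinants -/

namespace ExteriorAlgebra

open CliffordAlgebra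

section Koszul

variable {A M : Type*} [CommRing A] [AddCommGroup M] [Module A M]

/-- The Koszul differential of a linear form. -/
noncomputable def koszul (φ : Module.Dual A M) : ExteriorAlgebra A M →ₗ[A] ExteriorAlgebra A M :=
  contractLeft (Q := (0 : QuadraticForm A M)) φ

theorem koszul_ι_mul (φ : Module.Dual A M) (v : M) (x : ExteriorAlgebra A M) :
    koszul φ (ι A v * x) = φ v • x - ι A v * koszul φ x :=
  contractLeft_ι_mul (Q := (0 : QuadraticForm A M)) φ v x

theorem koszul_koszul (φ : Module.Dual A M) (x : ExteriorAlgebra A M) :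
    koszul φ (koszul φ x) = 0 :=
  contractLeft_contractLeft (Q := (0 : QuadraticForm A M)) φ x

theorem koszul_one (φ : Module.Dual A M) : koszul φ (1 : ExteriorAlgebra A M) = 0 :=
  contractLeft_one (Q := (0 : QuadraticForm A M)) φ

theorem mul_mem_ideal_smul_top {G : Ideal A} (y : ExteriorAlgebra A M) {x : ExteriorAlgebra A M}
    (hx : x ∈ G • (⊤ : Submodule A (ExteriorAlgebra A M))) :
    y * x ∈ G • (⊤ : Submodule A (ExteriorAlgebra A M)) :=
  Submodule.smul_top_le_comap_smul_top G (LinearMap.mulLeft A y) hx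

theorem koszul_mem_ideal_smul_top {G : Ideal A} (φ : Module.Dual A M) {x : ExteriorAlgebra A M}
    (hx : x ∈ G • (⊤ : Submodule A (ExteriorAlgebra A M))) :
    koszul φ x ∈ G • (⊤ : Submodule A (ExteriorAlgebra A M)) :=
  Submodule.smul_top_le_comap_smul_top G (koszul φ) hx

theorem koszul_mem_range_smul_top (φ : Module.Dual A M) (x : ExteriorAlgebra A M) :
    koszul φ x ∈ (LinearMap.range φ : Ideal A) • (⊤ : Submodule A (ExteriorAlgebra A M)) := by
  induction x using CliffordAlgebra.left_induction with
  | algebraMap r =>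
    rw [show koszul φ (algebraMap A _ r) = 0 from
      contractLeft_algebraMap (Q := (0 : QuadraticForm A M)) φ r]
    exact zero_mem _
  | add x y hx hy => rw [map_add]; exact add_mem hx hy
  | ι_mul x v hx =>
    rw [show koszul φ (CliffordAlgebra.ι 0 v * x) = φ v • x - ι A v * koszul φ x from
      koszul_ι_mul φ v x]
    exact sub_mem (Submodule.smul_mem_smul (LinearMap.mem_range_self φ v) trivial)
      (mul_mem_ideal_smul_top _ hx)

theorem koszul_ιMulti_mem (φ : Module.Dual A M) {n : ℕ} (v : Fin n → M) :
    koszul φ (ιMulti A n v) ∈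
      Ideal.span (Set.range (φ ∘ v)) • (⊤ : Submodule A (ExteriorAlgebra A M)) := by
  induction n with
  | zero => rw [ιMulti_zero_apply, koszul_one]; exact zero_mem _
  | succ n ih =>
    rw [ιMulti_succ_apply, koszul_ι_mul]
    refine sub_mem (Submodule.smul_mem_smul (Ideal.subset_span ⟨0, rfl⟩) trivial)
      (mul_mem_ideal_smul_top _ (Submodule.smul_mono_left (Ideal.span_mono ?_) (ih _)))
    rintro _ ⟨i, rfl⟩
    exact ⟨i.succ, rfl⟩

/-- Each induction step strips one vector off the wedge, using regularity of the `φ (v i)` modulo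
the later ones; at the end only r • 1 remains. -/
theorem mem_range_koszul_of_smul_ιMulti_mem {κ : Type*}
    (b : Module.Basis κ A (ExteriorAlgebra A M)) (φ : Module.Dual A M) {n : ℕ} (v : Fin n → M)
    (reg : ∀ i x, φ (v i) * x ∈ Ideal.span ((φ ∘ v) '' Set.Ioi i) →
      x ∈ Ideal.span ((φ ∘ v) '' Set.Ioi i)) (r : A)
    (h : r • ιMulti A n v ∈ LinearMap.range (koszul φ) ⊔
      Ideal.span (Set.range (φ ∘ v)) • (⊤ : Submodule A (ExteriorAlgebra A M))) :
    r • (1 : ExteriorAlgebra A M) ∈ LinearMap.range (koszul φ) := by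
  induction n with
  | zero => simpa using h
  | succ n ih =>
    have hIoi : ∀ i : Fin n, (φ ∘ v) '' Set.Ioi i.succ = (φ ∘ Matrix.vecTail v) '' Set.Ioi i := by
      intro i
      rw [← Fin.image_succ_Ioi, Set.image_image]
      rfl
    have hIoi0 : (φ ∘ v) '' Set.Ioi 0 = Set.range (φ ∘ Matrix.vecTail v) := by
      ext x
      constructor
      · rintro ⟨i, hi, rfl⟩
        exact ⟨i.pred (ne_of_gt hi), by simp [Matrix.vecTail]⟩
      · rintro ⟨i, rfl⟩
        exact ⟨i.succ, Fin.succ_pos i, rfl⟩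
    have hrange : Set.range (φ ∘ v) = insert (φ (v 0)) (Set.range (φ ∘ Matrix.vecTail v)) := by
      ext x
      simp [Matrix.vecTail, Fin.exists_fin_succ, eq_comm]
    refine ih (Matrix.vecTail v) (fun i x hx => ?_) ?_
    · rw [← hIoi] at hx ⊢
      exact reg i.succ x hx
    · set G := Ideal.span (Set.range (φ ∘ Matrix.vecTail v)) with hG
      set w := ιMulti A n (Matrix.vecTail v) with hw
      rw [hrange, Ideal.span_insert, Submodule.sup_smul, ιMulti_succ_apply] at h
      obtain ⟨_, ⟨y, rfl⟩, z, hz, hyz⟩ := Submodule.mem_sup.1 h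
      obtain ⟨z₁, hz₁, z₂, hz₂, rfl⟩ := Submodule.mem_sup.1 hz
      rw [Submodule.ideal_span_singleton_smul] at hz₁
      obtain ⟨z₁, -, rfl⟩ := hz₁
      -- Applying the differential kills the boundary of y. As the boundary of w lies in G • ⊤, what
      -- is left says that φ (v 0) • (r • w - koszul φ z₁) does too, and φ (v 0) cancels.
      have hd := congrArg (koszul φ) hyz
      simp only [map_add, koszul_koszul, map_smul, koszul_ι_mul, zero_add,
        DistribSMul.toLinearMap_apply] at hd
      have hreg : φ (v 0) • (r • w - koszul φ z₁) ∈
          G • (⊤ : Submodule A (ExteriorAlgebra A M)) := by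
        have : φ (v 0) • (r • w - koszul φ z₁) =
            koszul φ z₂ + r • (ι A (v 0) * koszul φ w) := by
          linear_combination (norm := module) (-1 : A) • hd
        rw [this]
        exact add_mem (koszul_mem_ideal_smul_top φ hz₂)
          (Submodule.smul_mem _ _ (mul_mem_ideal_smul_top _ (koszul_ιMulti_mem φ _)))
      have hmem : r • w - koszul φ z₁ ∈ G • (⊤ : Submodule A (ExteriorAlgebra A M)) := by
        rw [b.mem_ideal_smul_top_iff] at hreg ⊢
        intro s
        have := hreg s
        rw [hG, ← hIoi0] at this ⊢
        exact reg 0 _ (by simpa using this)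
      exact Submodule.mem_sup.2 ⟨_, ⟨z₁, rfl⟩, _, hmem, by simp⟩

end Koszul

end ExteriorAlgebra

theorem AlternatingMap.eq_basis_det_smul {A M N ι : Type*} [CommRing A] [AddCommGroup M]
    [Module A M] [AddCommGroup N] [Module A N] [Fintype ι] [DecidableEq ι]
    (e : Module.Basis ι A M) (F : M [⋀^ι]→ₗ[A] N) (v : ι → M) : F v = e.det v • F e := by
  have : F = (LinearMap.toSpanSingleton A N (F e)).compAlternatingMap e.det := by
    refine Module.Basis.ext_alternating e fun i h => ?_
    let σ : Equiv.Perm ι := Equiv.ofBijective i (Finite.injective_iff_bijective.1 h)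
    change F (e ∘ σ) = (LinearMap.toSpanSingleton A N (F e)).compAlternatingMap e.det (e ∘ σ)
    simp [AlternatingMap.map_perm, Module.Basis.det_self]
  conv_lhs => rw [this]
  rfl

/-- If `g = C f`, where `g` is a regular sequence, then multiplication by `det C` induces an
injective map `A ⧸ (f) → A ⧸ (g)`. -/
theorem Ideal.mem_span_of_mul_det_mem_span {A : Type*} [CommRing A] {n : ℕ} (f g : Fin n → A)
    (C : Matrix (Fin n) (Fin n) A) (hC : C.mulVec f = g)
    (reg : ∀ i x, g i * x ∈ Ideal.span (g '' Set.Ioi i) → x ∈ Ideal.span (g '' Set.Ioi i))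
    (r : A) (h : r * C.det ∈ Ideal.span (Set.range g)) : r ∈ Ideal.span (Set.range f) := by
  let φ : Module.Dual A (Fin n → A) := Fintype.linearCombination A f
  have hφ : φ ∘ (fun i => C i) = g := by
    rw [← hC]
    ext i
    simp [φ, Fintype.linearCombination_apply, Matrix.mulVec, dotProduct]
  have hrange : (LinearMap.range φ : Ideal A) = Ideal.span (Set.range f) :=
    Fintype.range_linearCombination A f
  have hdet : ExteriorAlgebra.ιMulti A n (fun i => C i) =
      C.det • ExteriorAlgebra.ιMulti A n (Pi.basisFun A (Fin n)) := by
    rw [AlternatingMap.eq_basis_det_smul (Pi.basisFun A (Fin n)), Pi.basisFun_det_apply]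
    rfl
  have key := ExteriorAlgebra.mem_range_koszul_of_smul_ιMulti_mem
    (Pi.basisFun A (Fin n)).ExteriorAlgebra φ (fun i => C i)
    (fun i x => by rw [hφ]; exact fun hx => reg i x (by rwa [← hφ] at hx ⊢)) r (by
      rw [hφ, hdet, smul_smul]
      exact Submodule.mem_sup_right (Submodule.smul_mem_smul h trivial))
  obtain ⟨y, hy⟩ := key
  have hmem := ExteriorAlgebra.koszul_mem_range_smul_top φ y
  rw [hy, hrange] at hmem
  have := Submodule.smul_top_le_comap_smul_top _
    (ExteriorAlgebra.algebraMapInv (R := A) (M := Fin n → A)).toLinearMap hmem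
  simpa using this

/-! ### The monomial ideal of N-th powers -/

open MvPolynomial

theorem MvPolynomial.mem_span_X_pow_image_iff {σ R : Type*} [CommSemiring R] {N : ℕ} {s : Set σ}
    {p : MvPolynomial σ R} :
    p ∈ Ideal.span ((fun i => (X i : MvPolynomial σ R) ^ N) '' s) ↔
      ∀ a ∈ p.support, ∃ i ∈ s, N ≤ a i := by
  have := mem_ideal_span_monomial_image (R := R) (x := p)
    (s := (fun i => Finsupp.single i N) '' s)
  rw [Set.image_image] at this
  simp only [X_pow_eq_monomial, this, Set.exists_mem_image, Finsupp.single_le_iff]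

theorem MvPolynomial.mem_span_X_pow_image_of_X_pow_mul_mem {σ R : Type*} [CommSemiring R] {N : ℕ}
    {s : Set σ} {i : σ} (hi : i ∉ s) {p : MvPolynomial σ R}
    (h : X i ^ N * p ∈ Ideal.span ((fun i => (X i : MvPolynomial σ R) ^ N) '' s)) :
    p ∈ Ideal.span ((fun i => (X i : MvPolynomial σ R) ^ N) '' s) := by
  rw [mem_span_X_pow_image_iff] at h ⊢
  intro a ha
  obtain ⟨j, hj, hN⟩ := h (Finsupp.single i N + a) (by
    rw [X_pow_eq_monomial, mem_support_iff, coeff_monomial_mul, one_mul]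
    exact mem_support_iff.1 ha)
  refine ⟨j, hj, ?_⟩
  have hij : i ≠ j := fun e => hi (e ▸ hj)
  simpa [hij] using hN

theorem MvPolynomial.mem_span_range_X_pow_iff {σ R : Type*} [CommSemiring R] {N : ℕ}
    {p : MvPolynomial σ R} :
    p ∈ Ideal.span (Set.range fun i => (X i : MvPolynomial σ R) ^ N) ↔
      ∀ a ∈ p.support, ∃ i, N ≤ a i := by
  rw [← Set.image_univ, mem_span_X_pow_image_iff]
  simp

theorem MvPolynomial.idealOfVars_pow_le_span_range_X_pow (σ R : Type*) [Fintype σ]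
    [CommSemiring R] {N D : ℕ} (hD : Fintype.card σ * N < D + Fintype.card σ) :
    idealOfVars σ R ^ D ≤ Ideal.span (Set.range fun i => (X i : MvPolynomial σ R) ^ N) := by
  intro p hp
  rw [mem_pow_idealOfVars_iff] at hp
  rw [mem_span_range_X_pow_iff]
  intro a ha
  by_contra! hlt
  have h1 : a.degree + Fintype.card σ ≤ Fintype.card σ * N := by
    rw [Finsupp.degree_eq_sum]
    calc ∑ i, a i + Fintype.card σ = ∑ i, (a i + 1) := by simp [Finset.sum_add_distrib]
      _ ≤ ∑ _i : σ, N := Finset.sum_le_sum fun i _ => hlt i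
      _ = _ := by simp
  have := hp a ha
  omega

/-- Between two exponent vectors there is one of every intermediate degree. -/
theorem Finsupp.exists_degree_eq_add_le {σ : Type*} [Fintype σ] (a : σ →₀ ℕ) (N i : ℕ)
    (ha : ∀ l, a l < N) (hdeg : a.degree + i + Fintype.card σ ≤ Fintype.card σ * N) :
    ∃ b : σ →₀ ℕ, b.degree = i ∧ ∀ l, (b + a) l < N := by
  induction i with
  | zero => exact ⟨0, by simp, by simpa using ha⟩
  | succ i ih =>
    obtain ⟨b, hb, hlt⟩ := ih (by omega)
    obtain ⟨l, hl⟩ : ∃ l, (b + a) l + 1 < N := by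
      by_contra! h
      have : Fintype.card σ * N ≤ (b + a).degree + Fintype.card σ := by
        rw [Finsupp.degree_eq_sum]
        calc Fintype.card σ * N = ∑ _i : σ, N := by simp
          _ ≤ ∑ i, ((b + a) i + 1) := Finset.sum_le_sum fun i _ => h i
          _ = _ := by simp [Finset.sum_add_distrib]
      rw [map_add] at this
      omega
    classical
    refine ⟨Finsupp.single l 1 + b, by simp [hb, add_comm], fun j => ?_⟩
    have := hlt j
    by_cases hj : l = j
    · subst hj
      simp only [Finsupp.add_apply, Finsupp.single_eq_same] at hl ⊢
      omega
    · simpa [hj] using this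

/-- A monomial of h with all exponents below N has room for a further factor of degree i, and that
product would still avoid the ideal. -/
theorem MvPolynomial.mem_span_range_X_pow_of_forall_mul_mem {σ R : Type*} [Fintype σ]
    [CommSemiring R] {N i : ℕ} {h : MvPolynomial σ R}
    (hdeg : ∀ a ∈ h.support, a.degree + i + Fintype.card σ ≤ Fintype.card σ * N)
    (hm : ∀ q ∈ idealOfVars σ R ^ i,
      q * h ∈ Ideal.span (Set.range fun i => (X i : MvPolynomial σ R) ^ N)) :
    h ∈ Ideal.span (Set.range fun i => (X i : MvPolynomial σ R) ^ N) := by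
  rw [mem_span_range_X_pow_iff]
  intro a ha
  by_contra! hlt
  obtain ⟨b, hb, hb'⟩ := a.exists_degree_eq_add_le N i hlt (hdeg a ha)
  have hmon : monomial b (1 : R) ∈ idealOfVars σ R ^ i := by
    rw [pow_idealOfVars_eq_span]
    exact Ideal.subset_span ⟨b, hb, rfl⟩
  obtain ⟨l, hl⟩ := mem_span_range_X_pow_iff.1 (hm _ hmon) (b + a) (by
    rw [mem_support_iff, coeff_monomial_mul, one_mul]
    exact mem_support_iff.1 ha)
  exact absurd (hb' l) (not_lt.2 hl)

-- Homogeneous coefficients and degree truncation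

attribute [local instance] MvPolynomial.gradedAlgebra in
theorem MvPolynomial.exists_isHomogeneous_mulVec_eq {σ ι κ R : Type*} [CommSemiring R]
    [Fintype ι] (f : ι → MvPolynomial σ R) (d : ι → ℕ) (hf : ∀ j, (f j).IsHomogeneous (d j))
    (g : κ → MvPolynomial σ R) (N : ℕ) (hg : ∀ i, (g i).IsHomogeneous N) (hN : ∀ j, d j ≤ N)
    (hmem : ∀ i, g i ∈ Ideal.span (Set.range f)) :
    ∃ C : Matrix κ ι (MvPolynomial σ R), C.mulVec f = g ∧
      ∀ i j, (C i j).IsHomogeneous (N - d j) := by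
  choose c hc using fun i => Ideal.mem_span_range_iff_exists_fun.1 (hmem i)
  -- Only these components contribute to degree N; d j ≤ N makes the subtraction exact.
  refine ⟨fun i j => homogeneousComponent (N - d j) (c i j), ?_,
    fun i j => homogeneousComponent_isHomogeneous _ _⟩
  ext1 i
  have key : ∀ j, homogeneousComponent N (c i j * f j) =
      homogeneousComponent (N - d j) (c i j) * f j := by
    intro j
    have := DirectSum.coe_decompose_mul_of_right_mem_of_le (homogeneousSubmodule σ R)
      (a := c i j) (hf j) (hN j)
    simp only [← decomposition.decompose'_apply]
    exact this
  simp only [Matrix.mulVec, dotProduct, ← key]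
  rw [← map_sum, hc, homogeneousComponent_eq_self (hg i)]

theorem MvPolynomial.isHomogeneous_det {σ ι R : Type*} [CommRing R] [Fintype ι] [DecidableEq ι]
    (C : Matrix ι ι (MvPolynomial σ R)) (e : ι → ℕ) (hC : ∀ i j, (C i j).IsHomogeneous (e j)) :
    C.det.IsHomogeneous (∑ j, e j) := by
  rw [Matrix.det_apply]
  refine IsHomogeneous.sum _ _ _ fun s _ => ?_
  have : (∏ i, C (s i) i).IsHomogeneous (∑ j, e j) := IsHomogeneous.prod _ _ _ fun i _ => hC _ _
  rcases Int.units_eq_one_or (Equiv.Perm.sign s) with h | h <;> simp [h, this, this.neg]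

theorem MvPolynomial.exists_eq_add_mem_idealOfVars_pow {σ R : Type*} [CommSemiring R]
    (r : MvPolynomial σ R) (D : ℕ) : ∃ r₁ r₂ : MvPolynomial σ R, r = r₁ + r₂ ∧
      (∀ a ∈ r₁.support, a.degree < D) ∧ r₂ ∈ idealOfVars σ R ^ D := by
  classical
  refine ⟨∑ a ∈ r.support with a.degree < D, monomial a (r.coeff a),
    ∑ a ∈ r.support with ¬ a.degree < D, monomial a (r.coeff a), ?_, fun a ha => ?_, ?_⟩
  · rw [Finset.sum_filter_add_sum_filter_not]
    exact r.as_sum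
  · obtain ⟨b, hb, hab⟩ := Finset.mem_biUnion.1 (support_sum ha)
    obtain rfl := Finset.mem_singleton.1 (support_monomial_subset hab)
    exact (Finset.mem_filter.1 hb).2
  · refine Ideal.sum_mem _ fun a ha => ?_
    rw [Finset.mem_filter, mem_support_iff] at ha
    rw [monomial_mem_pow_idealOfVars_iff _ _ ha.1]
    exact not_lt.1 ha.2

theorem MvPolynomial.IsHomogeneous.mem_idealOfVars_pow {σ R : Type*} [CommSemiring R]
    {p : MvPolynomial σ R} {D : ℕ} (hp : p.IsHomogeneous D) : p ∈ idealOfVars σ R ^ D := by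
  rw [mem_pow_idealOfVars_iff']
  exact fun a ha => hp.coeff_eq_zero ha.ne

-- From height n to powers of the variables

attribute [local instance] MvPolynomial.gradedAlgebra in
theorem MvPolynomial.le_idealOfVars_of_isHomogeneous {σ k : Type*} [Field k]
    {I : Ideal (MvPolynomial σ k)} (hI : I.IsHomogeneous (homogeneousSubmodule σ k))
    (hne : I ≠ ⊤) : I ≤ idealOfVars σ k := by
  intro p hp
  rw [← pow_one (idealOfVars σ k), mem_pow_idealOfVars_iff']
  intro a ha
  obtain rfl : a = 0 := (Finsupp.degree_eq_zero_iff a).1 (Nat.lt_one_iff.1 ha)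
  by_contra h0
  refine hne (Ideal.eq_top_of_isUnit_mem _ (homogeneousComponent_mem_of_mem hI hp 0) ?_)
  rw [homogeneousComponent_zero]
  exact (isUnit_iff_ne_zero.2 h0).map C

theorem MvPolynomial.height_idealOfVars_le (k : Type*) [Field k] (n : ℕ) :
    (idealOfVars (Fin n) k).height ≤ n := by
  have hne : idealOfVars (Fin n) k ≠ ⊤ := by
    rw [Ne, Ideal.eq_top_iff_one, ← pow_one (idealOfVars _ _), ← C_1, C_mem_pow_idealOfVars_iff]
    simp
  refine (Ideal.height_le_spanFinrank _ hne).trans ?_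
  refine Nat.cast_le.2 ((Submodule.spanFinrank_span_le_ncard_of_finite
    (Set.finite_range _)).trans ?_)
  rw [← Set.image_univ]
  exact (Set.ncard_image_le Set.finite_univ).trans (by simp)

-- The radical is the intersection of the homogeneous primes above I. Each lies in the ideal of the
-- variables and has at least its height, hence equals it.
attribute [local instance] MvPolynomial.gradedAlgebra in
theorem MvPolynomial.idealOfVars_le_radical {k : Type*} [Field k] {n : ℕ}
    {I : Ideal (MvPolynomial (Fin n) k)} (hI : I.IsHomogeneous (homogeneousSubmodule (Fin n) k))
    (hheight : (n : ℕ∞) ≤ I.height) : idealOfVars (Fin n) k ≤ I.radical := by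
  rw [hI.radical_eq]
  refine le_sInf ?_
  rintro J ⟨hJ, hIJ, hprime⟩
  exact (Ideal.eq_of_le_of_height_le J (le_idealOfVars_of_isHomogeneous hJ hprime.ne_top)
    ((height_idealOfVars_le k n).trans (hheight.trans (Ideal.height_mono hIJ)))).ge

attribute [local instance] MvPolynomial.gradedAlgebra in
theorem MvPolynomial.exists_forall_X_pow_mem {k : Type*} [Field k] {n : ℕ} (d : Fin n → ℕ)
    (f : Fin n → MvPolynomial (Fin n) k) (hf : ∀ j, (f j).IsHomogeneous (d j))
    (hheight : (n : ℕ∞) ≤ (Ideal.span (Set.range f)).height) :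
    ∃ N, (∀ j, d j ≤ N) ∧ ∀ i, X i ^ N ∈ Ideal.span (Set.range f) := by
  have hhom : (Ideal.span (Set.range f)).IsHomogeneous (homogeneousSubmodule (Fin n) k) :=
    Ideal.homogeneous_span _ _ (by rintro _ ⟨j, rfl⟩; exact ⟨d j, hf j⟩)
  choose e he using fun i : Fin n =>
    idealOfVars_le_radical hhom hheight (Ideal.subset_span (Set.mem_range_self i))
  refine ⟨∑ j, d j + ∑ i, e i, fun j => ?_, fun i => ?_⟩
  · exact (Finset.single_le_sum (fun _ _ => Nat.zero_le _) (Finset.mem_univ j)).trans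
      (Nat.le_add_right _ _)
  · refine Ideal.pow_mem_of_pow_mem _ (he i) ?_
    exact (Finset.single_le_sum (fun _ _ => Nat.zero_le _) (Finset.mem_univ i)).trans
      (Nat.le_add_left _ _)

theorem theorem1p1 {k : Type*} [Field k] (n : ℕ) (d : Fin n → ℕ)
    (f : Fin n → MvPolynomial (Fin n) k) (hf : ∀ j, (f j).IsHomogeneous (d j))
    (I m : Ideal (MvPolynomial (Fin n) k))
    (hI : I = Ideal.span (Set.range f)) (hheight : I.height = (n : ℕ∞))
    (hm : m = Ideal.span (Set.range (MvPolynomial.X : Fin n → MvPolynomial (Fin n) k))) :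
    ∃ δ : ℕ, (δ : ℤ) = ∑ j, (d j : ℤ) - (n : ℤ) ∧
      ∀ i : ℕ, i ≤ δ + 1 →
        I.colon ((m ^ i : Ideal (MvPolynomial (Fin n) k)) : Set (MvPolynomial (Fin n) k)) =
          I + m ^ (δ + 1 - i) := by
  obtain ⟨N, hdN, hN⟩ := MvPolynomial.exists_forall_X_pow_mem d f hf (hI ▸ hheight.ge)
  obtain ⟨C, hC, hChom⟩ := MvPolynomial.exists_isHomogeneous_mulVec_eq f d hf
    (fun i => (MvPolynomial.X i : MvPolynomial (Fin n) k) ^ N) N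
    (fun i => MvPolynomial.isHomogeneous_X_pow i N) hdN hN
  set J := Ideal.span (Set.range fun i => (MvPolynomial.X i : MvPolynomial (Fin n) k) ^ N) with hJ
  have hker : ∀ r, r * C.det ∈ J → r ∈ I := fun r hr => by
    rw [hI]
    exact Ideal.mem_span_of_mul_det_mem_span f _ C hC
      (fun i x => MvPolynomial.mem_span_X_pow_image_of_X_pow_mul_mem (by simp)) r hr
  have hdetI : ∀ r ∈ I, r * C.det ∈ J := by
    intro r hr
    rw [hI] at hr
    obtain ⟨c, rfl⟩ := Ideal.mem_span_range_iff_exists_fun.1 hr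
    rw [Finset.sum_mul]
    refine J.sum_mem fun j _ => ?_
    have hadj : C.det * f j =
        ∑ i, C.adjugate j i * (MvPolynomial.X i : MvPolynomial (Fin n) k) ^ N := by
      have := congrFun (Matrix.mulVec_mulVec f C.adjugate C) j
      rw [hC, Matrix.adjugate_mul, Matrix.smul_mulVec, Matrix.one_mulVec] at this
      exact this.symm
    rw [mul_assoc, mul_comm (f j), hadj]
    exact J.mul_mem_left _ (J.sum_mem fun i _ =>
      J.mul_mem_left _ (Ideal.subset_span (Set.mem_range_self i)))
  have hdethom : C.det.IsHomogeneous (∑ j, (N - d j)) :=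
    MvPolynomial.isHomogeneous_det C _ hChom
  have hsum : ∑ j, (N - d j) + ∑ j, d j = n * N := by
    rw [← Finset.sum_add_distrib, Finset.sum_congr rfl fun j _ => Nat.sub_add_cancel (hdN j)]
    simp
  have hpowJ : ∀ D, n * N < D + n → m ^ D ≤ J := by
    intro D hD
    rw [hm]
    exact MvPolynomial.idealOfVars_pow_le_span_range_X_pow (Fin n) k (by simpa using hD)
  have hdetm : C.det ∈ m ^ ∑ j, (N - d j) := hm ▸ hdethom.mem_idealOfVars_pow
  have hn : n ≤ ∑ j, d j := by
    by_contra! hlt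
    -- If ∑ d_j < n, then deg det C > n(N-1), so det C itself lies in J.
    have h1 : (1 : MvPolynomial (Fin n) k) ∈ I :=
      hker 1 (by rw [one_mul]; exact hpowJ _ (by omega) hdetm)
    rw [(Ideal.eq_top_iff_one I).2 h1, Ideal.height_top] at hheight
    exact ENat.top_ne_natCast n hheight
  refine ⟨∑ j, d j - n, by push_cast [Nat.cast_sub hn]; rfl, fun i hi => ?_⟩
  set δ := ∑ j, d j - n with hδ
  have hmI : m ^ (δ + 1) ≤ I := fun p hp => hker p (hpowJ (δ + 1 + ∑ j, (N - d j)) (by omega)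
    (by rw [pow_add]; exact Ideal.mul_mem_mul hp hdetm))
  have hpow : m ^ (δ + 1 - i) * m ^ i ≤ I := by
    rw [← pow_add, Nat.sub_add_cancel hi]
    exact hmI
  refine le_antisymm (fun r hr => ?_) (sup_le Ideal.le_colon fun r hr =>
    Submodule.mem_colon.2 fun s hs => hpow (Ideal.mul_mem_mul hr hs))
  obtain ⟨r₁, r₂, rfl, hr₁, hr₂⟩ : ∃ r₁ r₂ : MvPolynomial (Fin n) k, r = r₁ + r₂ ∧
      (∀ a ∈ r₁.support, a.degree < δ + 1 - i) ∧ r₂ ∈ m ^ (δ + 1 - i) := by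
    rw [hm]
    exact MvPolynomial.exists_eq_add_mem_idealOfVars_pow r _
  -- Since deg r₁ ≤ δ - i, every monomial of r₁ det C has degree at most n(N-1) - i, which leaves
  -- room for a factor of degree i.
  refine Submodule.add_mem_sup (hker r₁ ?_) hr₂
  refine MvPolynomial.mem_span_range_X_pow_of_forall_mul_mem (i := i) ?_ ?_
  · intro a ha
    obtain ⟨b, hb, c, hc, rfl⟩ := Finset.mem_add.1 (MvPolynomial.support_mul _ _ ha)
    have h1 := hr₁ b hb
    have h2 := hdethom.degree_eq_sum_deg_support hc
    rw [← Finsupp.degree_apply] at h2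
    rw [map_add, Fintype.card_fin]
    omega
  · intro q hq
    rw [← mul_assoc]
    refine hdetI _ ?_
    replace hq : q ∈ m ^ i := hm ▸ hq
    have h1 := Submodule.mem_colon.1 hr q hq
    rw [smul_eq_mul, add_mul] at h1
    rw [mul_comm]
    exact (Submodule.add_mem_iff_left _ (hpow (Ideal.mul_mem_mul hr₂ hq))).1 h1
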